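/- An s-manifold $\boldsymbol{X}=(X,\{X^i:i\in I\})$ of dimension $n\geq 0$ consists of a locally compact, Hausdorff, second countable topological space $X$ and a partition $X=\coprod_{i\in I}X^i$ into finitely or countably many nonempty, locally closed subsets $X^i$ (the strata), each equipped with the structure of a smooth manifold (inducing the subspace topology) of dimension $\dim X^i\leq n$, such that: (1) every $x\in X$ has an open neighbourhood $U$ in $X$ and a continuous map $f:U\to\mathbb{R}^N$, for some $N$ (which may depend on $x$), such that $f:U\to f(U)$ is a homeomorphism and $f|_{U\cap X^i}:U\cap X^i\to\mathbb{R}^N$ is a smooth embedding of manifolds for every $i\in I$; (2) every $x\in X$ has an open neighbourhood $V$ in $X$ such that $I_V:=\{i\in I:V\cap X^i\neq\emptyset\}$ is finite and there is a partial order $\preceq$ on $I_V$ with the following properties. For each $i\in I_V$, the closure of $V\cap X^i$ in $V$ is contained in $\coprod_{j\in I_V:\,i\preceq j}(V\cap X^j)$. For all $i\neq j$ in $I_V$ with $i\preceq j$, either $\dim X^i\in\{n-1,n\}$ and $\dim X^j<\dim X^i$, or $\dim X^i\leq n-2$ and $\dim X^j\leq n-2$. A map $f:X\to\mathbb{R}^N$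 is smooth if it is continuous and $f|_{X^i}:X^i\to\mathbb{R}^N$ is a smooth map of manifolds for every $i\in I$. A smooth map $f$ is an embedding if $f|_{X^i}:X^i\to\mathbb{R}^N$ is a smooth embedding of manifolds for every $i\in I$ and $f:X\to f(X)$ is a homeomorphism. **Theorem.** Let $\boldsymbol{X}$ be an s-manifold of dimension $n$. Then there exists a proper embedding $f:\boldsymbol{X}\to\mathbb{R}^{2n+1}$. -/

import Mathlib

open scoped Manifold ContDiff
open TopologicalSpace

universe u

/-- A stratification of a topological space `X` into countably many nonempty locally closed
subsets, each equipped (compatibly with its subspace topology) with the structure of a smooth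
manifold without boundary, of some dimension `dim s`. -/
structure ManifoldStratification (X : Type u) [TopologicalSpace X] where
  /-- The set of strata. -/
  strata : Set (Set X)
  countable_strata : strata.Countable
  nonempty : ∀ s ∈ strata, s.Nonempty
  isLocallyClosed : ∀ s ∈ strata, IsLocallyClosed s
  pairwiseDisjoint : strata.PairwiseDisjoint id
  sUnion_eq : ⋃₀ strata = Set.univ
  /-- The dimension of a stratum. -/
  dim : strata → ℕ
  /-- The charts of a stratum. -/
  chartedSpace : ∀ s : strata, ChartedSpace (EuclideanSpace ℝ (Fin (dim s))) (s : Set X)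
  /-- The charts of a stratum are smoothly compatible. -/
  isManifold : ∀ s : strata, IsManifold (𝓡 (dim s)) ∞ (s : Set X)

attribute [instance] ManifoldStratification.chartedSpace ManifoldStratification.isManifold

namespace ManifoldStratification

variable {X : Type u} [TopologicalSpace X] (S : ManifoldStratification X)

/-- The trace `U ∩ s` of an open subset `U` of `X` on a stratum `s`, as an open subset of the
manifold `s`. -/
def openTrace (U : Opens X) (s : S.strata) : Opens (s : Set X) :=
  U.comap ⟨Subtype.val, continuous_subtype_val⟩

/-- The restriction of a map `f`, defined on an open subset `U` of `X`, to the open subset `U ∩ s`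
of a stratum `s`. -/
def restrictTrace {Y : Type*} (U : Opens X) (f : U → Y) (s : S.strata) :
    S.openTrace U s → Y :=
  fun x => f ⟨x.1.1, x.2⟩

/-- The map `f` from an open subset `U` of `X` to `ℝᴺ` is a homeomorphism onto its image, and its
restriction to `U ∩ s` is a smooth embedding of manifolds for every stratum `s`. -/
def IsLocalEmbedding (U : Opens X) {N : ℕ} (f : U → EuclideanSpace ℝ (Fin N)) : Prop :=
  Topology.IsEmbedding f ∧
    ∀ s : S.strata, Manifold.IsSmoothEmbedding (𝓡 (S.dim s)) (𝓡 N) ∞ (S.restrictTrace U f s)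

/-- The strata that meet `V`. -/
abbrev StrataMeeting (V : Set X) : Type u :=
  {s : S.strata // (V ∩ (s : Set X)).Nonempty}

/-- The conditions on a partial order of the strata that meet an open set `V`, in an s-manifold of
dimension `n`. Here `dim = n - 1` and `dim ≤ n - 2` are written without subtraction. -/
structure IsFrontierOrder (n : ℕ) (V : Set X) (P : PartialOrder (S.StrataMeeting V)) : Prop where
  /-- The closure in `V` of `V ∩ s` lies in the union of the `V ∩ t` with `s ⪯ t`. -/
  closure_subset : ∀ s : S.StrataMeeting V,
    closure (V ∩ (s.1 : Set X)) ∩ V ⊆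
      ⋃ (t : S.StrataMeeting V) (_ : P.le s t), V ∩ (t.1 : Set X)
  dim_cond : ∀ s t : S.StrataMeeting V, s ≠ t → P.le s t →
    ((S.dim s.1 + 1 = n ∨ S.dim s.1 = n) ∧ S.dim t.1 < S.dim s.1) ∨
      (S.dim s.1 + 2 ≤ n ∧ S.dim t.1 + 2 ≤ n)

end ManifoldStratification

/-- The structure of an s-manifold (stratified manifold) of dimension `n` on a topological
space `X`. -/
structure SManifold (n : ℕ) (X : Type u) [TopologicalSpace X]
    extends ManifoldStratification X where
  locallyCompactSpace : LocallyCompactSpace X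
  t2Space : T2Space X
  secondCountableTopology : SecondCountableTopology X
  dim_le : ∀ s : strata, dim s ≤ n
  /-- Every point has an open neighbourhood that embeds in some `ℝᴺ`. -/
  exists_localEmbedding : ∀ x : X, ∃ U : Opens X, x ∈ U ∧
    ∃ (N : ℕ) (f : U → EuclideanSpace ℝ (Fin N)), toManifoldStratification.IsLocalEmbedding U f
  /-- Every point has an open neighbourhood that meets only finitely many strata, and these
  admit a partial order with the required properties. -/
  exists_frontierOrder : ∀ x : X, ∃ V : Set X, IsOpen V ∧ x ∈ V ∧
    Finite (toManifoldStratification.StrataMeeting V) ∧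
    ∃ P : PartialOrder (toManifoldStratification.StrataMeeting V),
      toManifoldStratification.IsFrontierOrder n V P

namespace SManifold

variable {n : ℕ} {X : Type u} [TopologicalSpace X] (S : SManifold n X)

/-- A smooth map from an s-manifold to the manifold `ℝᴺ` (an s-manifold with one stratum):
a continuous map whose restriction to every stratum is smooth. -/
def IsSmooth {N : ℕ} (f : X → EuclideanSpace ℝ (Fin N)) : Prop :=
  Continuous f ∧
    ∀ s : S.strata, ContMDiff (𝓡 (S.dim s)) (𝓡 N) ∞ (fun x : (s : Set X) => f x)

/-- An embedding of an s-manifold in `ℝᴺ`: a smooth map that restricts to a smooth embedding of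
manifolds on every stratum and is a homeomorphism onto its image. -/
structure IsEmbedding {N : ℕ} (f : X → EuclideanSpace ℝ (Fin N)) : Prop where
  isSmooth : S.IsSmooth f
  isSmoothEmbedding : ∀ s : S.strata,
    Manifold.IsSmoothEmbedding (𝓡 (S.dim s)) (𝓡 N) ∞ (fun x : (s : Set X) => f x)
  isEmbedding : Topology.IsEmbedding f

end SManifold

/-!
An s-manifold of dimension `n` embeds properly in `ℝ^(2n+1)` by a general position argument.

The local embeddings are cut off and patched together to a locally finite family of smooth
functions `g k : X → ℝ`, with `∑ k, |g k|` bounded, which separates the points of `X` and the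
tangent vectors of every stratum, together with a smooth function `ρ` tending to infinity
(`SManifold.exists_separating_family`). For a fixed unit vector `w` and a bounded family of
coefficients `a k ∈ ℝ^(2n+1)`, put `f = ρ • w + ∑ k, g k • a k` (`perturbedSum`). This is a smooth
map, and it is proper since it differs from `ρ • w` by a bounded amount.

For generic `a`, in the sense of Baire category in `ℓ^∞`, the map `f` is moreover injective and
immersive on every stratum. Both conditions say that a map of the form `G₀ + ∑ k, G k • a k`, with
functions `G k` without a common zero on an open subset of a vector space of dimension at
most `2n`, has no zero: the variables are a pair of points of two strata, read in charts, or a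
point of one stratum and a nonzero tangent vector. At a zero where `G k ≠ 0`, the coefficient `a k`
is determined by the other coefficients, so it lies in the image of a `C¹` map from a space of
dimension less than `2n + 1`. The complement of such an image is dense, and so the zeros disappear
after an arbitrarily small change of `a k`. This is `residual_forall_ne_zero`.

An injective proper map is a topological embedding. Since immersions are defined by a normal form
in charts, the equivalence of that normal form with the injectivity of the differential (one
direction of which is the inverse function theorem) is needed at both ends:
`mfderiv_injective_of_isImmersionAtOfComplement` for the given local embeddings, and
`isImmersionAtOfComplement_of_injective_fderiv` for `f`.
-/

open Filter Topology Module Manifold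

/-! ### Generic linear combinations have no zeros -/

section Genericity

variable {ι E W : Type*} [NormedAddCommGroup W]

theorem continuous_lp_single [DecidableEq ι] (k : ι) :
    Continuous fun w : W => lp.single (E := fun _ : ι => W) ⊤ k w := by
  refine (AddMonoidHomClass.isometry_of_norm
    (lp.singleAddMonoidHom (E := fun _ : ι => W) ⊤ k) fun w => ?_).continuous
  exact lp.norm_single (E := fun _ : ι => W) ENNReal.zero_lt_top k w

theorem continuous_lp_apply (k : ι) : Continuous fun a : lp (fun _ : ι => W) ⊤ => a k :=
  (lp.uniformContinuous_coe.continuous).comp continuous_id |> (continuous_apply k).comp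

variable [NormedSpace ℝ W] [NormedAddCommGroup E] [NormedSpace ℝ E] [FiniteDimensional ℝ E]

theorem dimH_image_lt_of_contDiffAt {φ : E → W} {K : Set E} (hdim : finrank ℝ E < finrank ℝ W)
    (hφ : ∀ z ∈ K, ContDiffAt ℝ 1 φ z) : dimH (φ '' K) < finrank ℝ W := by
  have h1 : dimH (φ '' K) ≤ dimH K := by
    refine dimH_image_le_of_locally_lipschitzOn fun z hz => ?_
    obtain ⟨C, t, ht, hC⟩ := (hφ z hz).exists_lipschitzOnWith
    exact ⟨C, t, mem_nhdsWithin_of_mem_nhds ht, hC⟩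
  have h2 : dimH K ≤ finrank ℝ E :=
    (dimH_mono (Set.subset_univ K)).trans (Real.dimH_univ_eq_finrank E).le
  exact (h1.trans h2).trans_lt (by exact_mod_cast hdim)

/-- Let `F a = G₀ + ∑ k, G k • a k` be a locally finite combination of `C¹` functions `G k` without
a common zero, on an open subset of a space of dimension less than that of `W`. For generic bounded
coefficients `a`, the map `F a` has no zero. -/
theorem residual_forall_ne_zero [FiniteDimensional ℝ W] (hdim : finrank ℝ E < finrank ℝ W)
    {Z : Set E} (hZ : IsOpen Z)
    {G : ι → E → ℝ} {G₀ : E → W} {F : lp (fun _ : ι => W) ⊤ → E → W}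
    (hG : ∀ k, ContDiffOn ℝ 1 (G k) Z) (hG₀ : ContDiffOn ℝ 1 G₀ Z)
    (hF : ∀ z₀ ∈ Z, ∃ T : Finset ι, ∀ᶠ z in 𝓝 z₀, (∀ k ∉ T, G k z = 0) ∧
      ∀ a, F a z = G₀ z + ∑ k ∈ T, G k z • a k)
    (hne : ∀ z ∈ Z, ∃ k, G k z ≠ 0) :
    ∀ᶠ a in residual (lp (fun _ : ι => W) ⊤), ∀ z ∈ Z, F a z ≠ 0 := by
  classical
  have hGat : ∀ k, ∀ z ∈ Z, ContDiffAt ℝ 1 (G k) z := fun k z hz =>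
    (hG k).contDiffAt (hZ.mem_nhds hz)
  have hFat : ∀ a, ∀ z ∈ Z, ContDiffAt ℝ 1 (F a) z := by
    intro a z hz
    obtain ⟨T, hT⟩ := hF z hz
    have h : ContDiffAt ℝ 1 (fun z => G₀ z + ∑ k ∈ T, G k z • a k) z :=
      (hG₀.contDiffAt (hZ.mem_nhds hz)).add
        (ContDiffAt.sum fun k _ => (hGat k z hz).smul contDiffAt_const)
    exact h.congr_of_eventuallyEq (hT.mono fun z hz => hz.2 a)
  -- On a compact set where `G k ≠ 0`, the good coefficients form a dense open set.
  have key : ∀ k, ∀ K ⊆ Z, IsCompact K → (∀ z ∈ K, G k z ≠ 0) →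
      ∀ᶠ a in residual (lp (fun _ : ι => W) ⊤), ∀ z ∈ K, F a z ≠ 0 := by
    intro k K hKZ hK hGK
    refine residual_of_dense_open (s := {a | ∀ z ∈ K, F a z ≠ 0}) ?_ ?_
    · refine isOpen_iff_mem_nhds.2 fun a ha => ?_
      refine hK.eventually_forall_of_forall_eventually fun z₀ hz₀ => ?_
      obtain ⟨T, hT⟩ := hF z₀ (hKZ hz₀)
      have hc : ContinuousAt (fun p : lp (fun _ : ι => W) ⊤ × E =>
          G₀ p.2 + ∑ k ∈ T, G k p.2 • p.1 k) (a, z₀) := by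
        have h2 : ContinuousAt (Prod.snd : lp (fun _ : ι => W) ⊤ × E → E) (a, z₀) :=
          continuousAt_snd
        refine ContinuousAt.add (ContinuousAt.comp (f := Prod.snd) (g := G₀)
          (hG₀.contDiffAt (hZ.mem_nhds (hKZ hz₀))).continuousAt h2) ?_
        refine tendsto_finsetSum _ fun k _ => ?_
        refine Tendsto.smul (ContinuousAt.comp (f := Prod.snd) (g := G k)
          (hGat k z₀ (hKZ hz₀)).continuousAt h2) ?_
        exact ((continuous_lp_apply k).comp continuous_fst).continuousAt
      have hne : (fun p : lp (fun _ : ι => W) ⊤ × E =>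
          G₀ p.2 + ∑ k ∈ T, G k p.2 • p.1 k) (a, z₀) ≠ 0 := by
        have := ha z₀ hz₀
        rwa [hT.self_of_nhds.2 a] at this
      filter_upwards [hc.eventually_ne hne,
        (continuous_snd.tendsto (a, z₀)).eventually hT] with p hp hp'
      rw [hp'.2]
      exact hp
    · intro a
      have hupd : ∀ z ∈ Z, ∀ w, F (a + lp.single ⊤ k w) z = F a z + G k z • w := by
        intro z hz w
        obtain ⟨T, hT⟩ := hF z hz
        obtain ⟨hT0, hT1⟩ := hT.self_of_nhds
        rw [hT1, hT1]
        simp only [lp.coeFn_add, Pi.add_apply, smul_add, Finset.sum_add_distrib, lp.single_apply,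
          add_assoc, add_right_inj]
        by_cases hk : k ∈ T
        · rw [Finset.sum_eq_single_of_mem k hk fun j _ hj => by simp [hj]]
          simp
        · rw [hT0 k hk, zero_smul]
          refine Finset.sum_eq_zero fun j hj => ?_
          have : j ≠ k := fun h => hk (h ▸ hj)
          simp [this]
      -- Replacing `a k` by `a k + w` creates a zero on `K` only for `w` in this image.
      have hdense : Dense ((fun z => -((G k z)⁻¹ • F a z)) '' K)ᶜ := by
        refine dense_compl_of_dimH_lt_finrank (dimH_image_lt_of_contDiffAt hdim fun z hz => ?_)
        exact (((hGat k z (hKZ hz)).inv (hGK z hz)).smul (hFat a z (hKZ hz))).neg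
      have hcont : Continuous fun w : W => a + lp.single (E := fun _ : ι => W) ⊤ k w :=
        continuous_const.add (continuous_lp_single k)
      have h0 := map_mem_closure hcont (hdense 0) (t := {a | ∀ z ∈ K, F a z ≠ 0}) (by
        intro w hw z hz h
        refine hw ⟨z, hz, ?_⟩
        rw [hupd z (hKZ hz)] at h
        have h' : F a z = -(G k z • w) := eq_neg_of_add_eq_zero_left h
        simp [h', smul_smul, inv_mul_cancel₀ (hGK z hz)])
      simpa using h0
  have hcover : ∀ z ∈ Z, ∃ K ∈ 𝓝 z,
      ∀ᶠ a in residual (lp (fun _ : ι => W) ⊤), ∀ y ∈ K, F a y ≠ 0 := by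
    intro z hz
    obtain ⟨k, hk⟩ := hne z hz
    obtain ⟨K, hKn, hKs, hKc⟩ := local_compact_nhds
      (Filter.inter_mem (hZ.mem_nhds hz) ((hGat k z hz).continuousAt.eventually_ne hk))
    exact ⟨K, hKn, key k K (fun y hy => (hKs hy).1) hKc fun y hy => (hKs hy).2⟩
  choose! K hKn hK using hcover
  obtain ⟨t, htZ, htc, ht⟩ := countable_cover_nhdsWithin (s := Z) (f := K) fun z hz =>
    mem_nhdsWithin_of_mem_nhds (hKn z hz)
  filter_upwards [(eventually_countable_ball htc).2 fun z hz => hK z (htZ hz)] with a ha z hz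
  obtain ⟨y, hy, hzy⟩ := Set.mem_iUnion₂.1 (ht hz)
  exact ha y hy z hzy

end Genericity

/-! ### Immersions and injectivity of the differential -/

section NormalForm

theorem exists_equiv_prod_apply_left_eq {d m : ℕ}
    (L : EuclideanSpace ℝ (Fin d) →L[ℝ] EuclideanSpace ℝ (Fin m)) (hL : Function.Injective L) :
    ∃ e : (EuclideanSpace ℝ (Fin d) × EuclideanSpace ℝ (Fin (m - d))) ≃L[ℝ]
      EuclideanSpace ℝ (Fin m), ∀ v, e (v, 0) = L v := by
  obtain ⟨Q, hQ⟩ := Submodule.exists_isCompl (LinearMap.range L.toLinearMap)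
  have hL' : Function.Injective L.toLinearMap := hL
  have h1 := Submodule.finrank_add_eq_of_isCompl hQ
  rw [LinearMap.finrank_range_of_inj hL'] at h1
  have h2 : finrank ℝ (EuclideanSpace ℝ (Fin (m - d))) = finrank ℝ Q := by
    simp only [finrank_euclideanSpace_fin] at h1 ⊢
    omega
  let e₁ := (LinearEquiv.ofInjective _ hL').prodCongr (LinearEquiv.ofFinrankEq _ _ h2)
  let e₂ := e₁.trans (Submodule.prodEquivOfIsCompl _ _ hQ)
  refine ⟨e₂.toContinuousLinearEquiv, fun v => ?_⟩
  simp [e₂, e₁]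

/-- The inverse function theorem, with a smooth inverse on the whole target: smoothness at the image
of `z` alone would not give it on a neighbourhood, so the source is cut down to points where the
derivative is invertible. -/
theorem exists_openPartialHomeomorph_contDiffOn {V : Type*} [NormedAddCommGroup V]
    [NormedSpace ℝ V] [CompleteSpace V] {Φ : V → V} {Ω : Set V} (hΩ : IsOpen Ω)
    (hΦ : ContDiffOn ℝ ∞ Φ Ω) {z : V} (hz : z ∈ Ω) {Φ' : V ≃L[ℝ] V}
    (hΦ' : HasFDerivAt Φ (Φ' : V →L[ℝ] V) z) :
    ∃ e : OpenPartialHomeomorph V V, z ∈ e.source ∧ e.source ⊆ Ω ∧ (e : V → V) = Φ ∧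
      ContDiffOn ℝ ∞ e.symm e.target := by
  have hat : ∀ y ∈ Ω, ContDiffAt ℝ ∞ Φ y := fun y hy => hΦ.contDiffAt (hΩ.mem_nhds hy)
  have hS : IsOpen (Ω ∩ fderiv ℝ Φ ⁻¹' Set.range ((↑) : (V ≃L[ℝ] V) → V →L[ℝ] V)) :=
    (hΦ.continuousOn_fderiv_of_isOpen hΩ (by simp)).isOpen_inter_preimage hΩ
      (ContinuousLinearEquiv.isOpen (𝕜 := ℝ) (E := V) (F := V))
  set S := Ω ∩ fderiv ℝ Φ ⁻¹' Set.range ((↑) : (V ≃L[ℝ] V) → V →L[ℝ] V) with hSdef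
  refine ⟨((hat z hz).toOpenPartialHomeomorph Φ hΦ' (by simp)).restrOpen S hS, ?_, ?_, rfl, ?_⟩
  · exact ⟨(hat z hz).mem_toOpenPartialHomeomorph_source hΦ' (by simp), hz, Φ', hΦ'.fderiv.symm⟩
  · exact fun y hy => hy.2.1
  · intro y hy
    have hy' := OpenPartialHomeomorph.map_target _ hy
    obtain ⟨hyΩ, A, hA⟩ := hy'.2
    refine ContDiffAt.contDiffWithinAt (OpenPartialHomeomorph.contDiffAt_symm (f₀' := A) _ hy ?_
      (hat _ hyΩ))
    rw [hA]
    exact ((hat _ hyΩ).differentiableAt (by simp)).hasFDerivAt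

end NormalForm

section Immersion

variable {d m : ℕ} {M : Type*} [TopologicalSpace M] [ChartedSpace (EuclideanSpace ℝ (Fin d)) M]

theorem mfderiv_injective_of_isImmersionAtOfComplement {F : Type*} [NormedAddCommGroup F]
    [NormedSpace ℝ F] [IsManifold (𝓡 d) ∞ M] {f : M → EuclideanSpace ℝ (Fin m)} {x : M}
    (h : IsImmersionAtOfComplement F (𝓡 d) (𝓡 m) ∞ f x) :
    Function.Injective (mfderiv (𝓡 d) (𝓡 m) f x) := by
  have : IsManifold (𝓡 d) 1 M := IsManifold.of_le (n := ∞) (by simp)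
  set φ := h.domChart
  set ψ := h.codChart
  have hx : x ∈ φ.source := h.mem_domChart_source
  have hφ : φ.MDifferentiable (𝓡 d) (𝓡 d) :=
    ⟨(contMDiffOn_of_mem_maximalAtlas h.domChart_mem_maximalAtlas).mdifferentiableOn (by simp),
     (contMDiffOn_symm_of_mem_maximalAtlas h.domChart_mem_maximalAtlas).mdifferentiableOn (by simp)⟩
  have hψ : MDifferentiableAt (𝓡 m) (𝓡 m) ψ (f x) :=
    (contMDiffAt_of_mem_maximalAtlas h.codChart_mem_maximalAtlas
      h.mem_codChart_source).mdifferentiableAt (by simp)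
  have hf : MDifferentiableAt (𝓡 d) (𝓡 m) f x := h.contMDiffAt.mdifferentiableAt (by simp)
  let J : EuclideanSpace ℝ (Fin d) →L[ℝ] EuclideanSpace ℝ (Fin m) :=
    h.equiv.toContinuousLinearMap.comp (ContinuousLinearMap.inl ℝ _ F)
  have hJ : HasMFDerivAt (𝓡 d) (𝓡 m) (h.equiv ∘ fun u => (u, 0)) (φ x) J :=
    J.hasFDerivAt.hasMFDerivAt
  have heq : (ψ ∘ f) =ᶠ[𝓝 x] ((h.equiv ∘ fun u => (u, 0)) ∘ φ) := by
    filter_upwards [φ.open_source.mem_nhds hx] with y hy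
    have hy' : φ y ∈ (φ.extend (𝓡 d)).target := by simpa using φ.map_source hy
    simpa [φ, φ.left_inv hy] using h.writtenInCharts hy'
  have h1 := heq.mfderiv_eq (I := 𝓡 d) (I' := 𝓡 m)
  rw [mfderiv_comp x hψ hf, mfderiv_comp x hJ.mdifferentiableAt (hφ.mdifferentiableAt hx),
    hJ.mfderiv] at h1
  intro v w hvw
  have h2 : (mfderiv (𝓡 m) (𝓡 m) ψ (f x)).comp (mfderiv (𝓡 d) (𝓡 m) f x) v =
      (mfderiv (𝓡 m) (𝓡 m) ψ (f x)).comp (mfderiv (𝓡 d) (𝓡 m) f x) w := by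
    simp only [ContinuousLinearMap.comp_apply, hvw]
  rw [h1] at h2
  have h3 := h.equiv.injective h2
  exact hφ.mfderiv_injective hx (Prod.ext_iff.1 h3).1

/-- A smooth map whose differential, in some chart `φ`, is injective at `x` is an immersion at `x`.
If `e` extends the differential to an isomorphism `ℝᵈ × ℝ^(m-d) ≃ ℝᵐ`, then
`e (u, v) ↦ f (φ⁻¹ u) + e (0, v)` is a local diffeomorphism with derivative `id`, and its inverse is
a chart of `ℝᵐ` in which `f` is linear. -/
theorem isImmersionAtOfComplement_of_injective_fderiv [IsManifold (𝓡 d) ∞ M]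
    {f : M → EuclideanSpace ℝ (Fin m)} (hf : ContMDiff (𝓡 d) (𝓡 m) ∞ f) {x : M}
    {φ : OpenPartialHomeomorph M (EuclideanSpace ℝ (Fin d))}
    (hφ : φ ∈ IsManifold.maximalAtlas (𝓡 d) ∞ M) (hx : x ∈ φ.source)
    (hinj : Function.Injective (fderiv ℝ (f ∘ φ.symm) (φ x))) :
    IsImmersionAtOfComplement (EuclideanSpace ℝ (Fin (m - d))) (𝓡 d) (𝓡 m) ∞ f x := by
  obtain ⟨e, he⟩ := exists_equiv_prod_apply_left_eq _ hinj
  have hg : ContDiffOn ℝ ∞ (f ∘ φ.symm) φ.target := contMDiffOn_iff_contDiffOn.1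
    (hf.comp_contMDiffOn (contMDiffOn_symm_of_mem_maximalAtlas hφ))
  have hxt := φ.map_source hx
  set g := f ∘ φ.symm with hgdef
  let q : EuclideanSpace ℝ (Fin m) →L[ℝ] EuclideanSpace ℝ (Fin m) :=
    e.toContinuousLinearMap.comp ((ContinuousLinearMap.inr ℝ _ _).comp
      ((ContinuousLinearMap.snd ℝ _ _).comp e.symm.toContinuousLinearMap))
  let P : EuclideanSpace ℝ (Fin m) →L[ℝ] EuclideanSpace ℝ (Fin d) :=
    (ContinuousLinearMap.fst ℝ _ _).comp e.symm.toContinuousLinearMap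
  let Φ : EuclideanSpace ℝ (Fin m) → EuclideanSpace ℝ (Fin m) := fun z => g (P z) + q z
  have hΩ : IsOpen (P ⁻¹' φ.target) := φ.open_target.preimage P.continuous
  have hPe : ∀ u, P (e (u, 0)) = u := fun u => by simp [P]
  have hqe : ∀ u, q (e (u, 0)) = 0 := fun u => by simp [q]
  have hΦe : ∀ u, Φ (e (u, 0)) = g u := fun u => by simp only [Φ, hPe, hqe, add_zero]
  have hΦ : ContDiffOn ℝ ∞ Φ (P ⁻¹' φ.target) :=
    (hg.comp P.contDiff.contDiffOn fun z hz => hz).add q.contDiff.contDiffOn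
  have hzΩ : e (φ x, 0) ∈ P ⁻¹' φ.target := by simpa [hPe] using hxt
  have hΦ' : HasFDerivAt Φ ((ContinuousLinearEquiv.refl ℝ (EuclideanSpace ℝ (Fin m)) :
      EuclideanSpace ℝ (Fin m) →L[ℝ] EuclideanSpace ℝ (Fin m))) (e (φ x, 0)) := by
    have h1 : HasFDerivAt g (fderiv ℝ g (φ x)) (P (e (φ x, 0))) := by
      rw [hPe]
      exact ((hg.contDiffAt (φ.open_target.mem_nhds hxt)).differentiableAt (by simp)).hasFDerivAt
    refine ((h1.comp _ P.hasFDerivAt).add q.hasFDerivAt).congr_fderiv ?_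
    ext1 z
    obtain ⟨⟨v, w⟩, rfl⟩ := e.surjective z
    have : e (v, w) = e (v, 0) + e (0, w) := by rw [← map_add]; simp
    simp [P, q, ← he, this]
  obtain ⟨E, hzE, hEΩ, hE, hEs⟩ := exists_openPartialHomeomorph_contDiffOn hΩ hΦ hzΩ hΦ'
  have hEz : E (e (φ x, 0)) = f x := by
    rw [hE, hΦe, hgdef, Function.comp_apply, φ.left_inv hx]
  have hcont : ContinuousOn (fun y => e (φ y, 0)) φ.source :=
    e.continuous.comp_continuousOn (φ.continuousOn.prodMk continuousOn_const)
  have hU : IsOpen (φ.source ∩ (fun y => e (φ y, 0)) ⁻¹' E.source) :=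
    hcont.isOpen_inter_preimage φ.open_source E.open_source
  refine IsImmersionAtOfComplement.mk_of_continuousAt hf.continuous.continuousAt e
    (φ.restr (φ.source ∩ (fun y => e (φ y, 0)) ⁻¹' E.source)) E.symm ?_ ?_ ?_ ?_ ?_
  · rw [φ.restr_source, hU.interior_eq]
    exact ⟨hx, hx, hzE⟩
  · rw [← hEz]
    exact E.map_source hzE
  · exact restr_mem_maximalAtlas (contDiffGroupoid ∞ (𝓡 d)) hφ hU
  · refine OpenPartialHomeomorph.mem_maximalAtlas_of_contMDiffOn _ ?_ ?_
    · exact contMDiffOn_iff_contDiffOn.2 hEs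
    · refine contMDiffOn_iff_contDiffOn.2 ?_
      simp only [OpenPartialHomeomorph.symm_symm, OpenPartialHomeomorph.symm_target, hE]
      exact hΦ.mono hEΩ
  · intro u hu
    have hu' : u ∈ φ.target ∧ e (u, 0) ∈ E.source := by
      obtain ⟨hu1, hu2⟩ : u ∈ φ.target ∧ φ.symm u ∈ interior
        ((fun y => e (φ y, 0)) ⁻¹' E.source) := by simpa using hu
      refine ⟨hu1, ?_⟩
      have hu3 := interior_subset hu2
      rwa [Set.mem_preimage, φ.right_inv hu1] at hu3
    have h1 : E (e (u, 0)) = f (φ.symm u) := by rw [hE, hΦe]; rfl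
    simp [← h1, E.left_inv hu'.2]

end Immersion

/-! ### Smooth functions with small support -/

namespace ManifoldStratification

variable {X : Type u} [TopologicalSpace X] (S : ManifoldStratification X)

/-- A real function on a stratified space is smooth if it is continuous and its restriction to
every stratum is smooth. -/
structure IsSmoothFunction (g : X → ℝ) : Prop where
  continuous : Continuous g
  contMDiff : ∀ s : S.strata, ContMDiff (𝓡 (S.dim s)) 𝓘(ℝ, ℝ) ∞ (fun x : (s : Set X) => g x)

variable {S} {U : Opens X} {N : ℕ} {f : U → EuclideanSpace ℝ (Fin N)}

theorem IsLocalEmbedding.contMDiffAt_extend (hf : S.IsLocalEmbedding U f) (s : S.strata)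
    (y : (s : Set X)) (hy : (y : X) ∈ U) :
    ContMDiffAt (𝓡 (S.dim s)) (𝓡 N) ∞
      (fun x : (s : Set X) => Function.extend Subtype.val f 0 (x : X)) y := by
  have h := (hf.2 s).contMDiff (⟨y, hy⟩ : S.openTrace U s)
  rw [← contMDiffAt_subtype_iff (U := S.openTrace U s) (x := ⟨y, hy⟩)]
  refine h.congr_of_eventuallyEq (Eventually.of_forall fun x => ?_)
  exact Subtype.val_injective.extend_apply f 0 (⟨x.1.1, x.2⟩ : U)

/-- The differential of the inclusion of the open subset `U ∩ s` in the stratum `s` is injective,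
hence bijective for dimension reasons, so the injectivity of the differential passes from `U ∩ s`
to `s`. -/
theorem IsLocalEmbedding.mfderiv_extend_injective (hf : S.IsLocalEmbedding U f) (s : S.strata)
    (y : (s : Set X)) (hy : (y : X) ∈ U) :
    Function.Injective (mfderiv (𝓡 (S.dim s)) (𝓡 N)
      (fun x : (s : Set X) => Function.extend Subtype.val f 0 (x : X)) y) := by
  obtain ⟨F, _, _, hF⟩ := (hf.2 s).isImmersion
  have h1 := mfderiv_injective_of_isImmersionAtOfComplement (hF (⟨y, hy⟩ : S.openTrace U s))
  have h2 : S.restrictTrace U f s =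
      (fun x : (s : Set X) => Function.extend Subtype.val f 0 (x : X)) ∘ Subtype.val := by
    ext1 x
    exact (Subtype.val_injective.extend_apply f 0 (⟨x.1.1, x.2⟩ : U)).symm
  rw [h2, mfderiv_comp (I' := 𝓡 (S.dim s)) (⟨y, hy⟩ : S.openTrace U s)
    ((hf.contMDiffAt_extend s y hy).mdifferentiableAt (by simp))
    ((contMDiff_subtype_val (n := ∞)).mdifferentiableAt (by simp))] at h1
  set A : EuclideanSpace ℝ (Fin (S.dim s)) →L[ℝ] EuclideanSpace ℝ (Fin (S.dim s)) :=
    mfderiv (𝓡 (S.dim s)) (𝓡 (S.dim s))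
      (Subtype.val : S.openTrace U s → (s : Set X)) ⟨y, hy⟩ with hA
  let B : EuclideanSpace ℝ (Fin (S.dim s)) →L[ℝ] EuclideanSpace ℝ (Fin N) :=
    mfderiv (𝓡 (S.dim s)) (𝓡 N)
      (fun x : (s : Set X) => Function.extend Subtype.val f 0 (x : X)) y
  have hAinj : Function.Injective A := fun v w hvw => h1 (congrArg B hvw)
  have hAsurj : Function.Surjective A :=
    (LinearMap.injective_iff_surjective (f := A.toLinearMap)).1 hAinj
  intro v w hvw
  obtain ⟨v, rfl⟩ := hAsurj v
  obtain ⟨w, rfl⟩ := hAsurj w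
  exact congrArg A (h1 hvw)

theorem IsLocalEmbedding.isSmoothFunction_comp_extend [T2Space X] (hf : S.IsLocalEmbedding U f)
    {K : Set X} (hK : IsCompact K) (hKU : K ⊆ U) {G : EuclideanSpace ℝ (Fin N) → ℝ}
    (hG : ContDiff ℝ ∞ G) (hG0 : ∀ y : U, (y : X) ∉ K → G (f y) = 0) :
    S.IsSmoothFunction (Function.extend Subtype.val (G ∘ f) 0) := by
  have hzero : ∀ y ∉ K, Function.extend Subtype.val (G ∘ f) 0 y = 0 := by
    intro y hy
    by_cases hyU : y ∈ U
    · exact (Subtype.val_injective.extend_apply (G ∘ f) 0 ⟨y, hyU⟩).trans (hG0 ⟨y, hyU⟩ hy)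
    · exact Function.extend_apply' _ _ _ (by simpa using hyU)
  constructor
  · refine continuous_iff_continuousAt.2 fun y => ?_
    by_cases hy : y ∈ K
    · refine (U.isOpenEmbedding'.continuousAt_iff (x := ⟨y, hKU hy⟩)).1 ?_
      rw [Function.extend_comp Subtype.val_injective]
      exact (hG.continuous.comp hf.1.continuous).continuousAt
    · refine continuousAt_const.congr (f := fun _ => (0 : ℝ)) ?_
      filter_upwards [hK.isClosed.isOpen_compl.mem_nhds hy] with z hz
      exact (hzero z hz).symm
  · intro s y
    by_cases hy : (y : X) ∈ K
    · refine ((hG.contMDiff (𝕜 := ℝ)).contMDiffAt.comp y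
        (hf.contMDiffAt_extend s y (hKU hy))).congr_of_eventuallyEq ?_
      filter_upwards [(S.openTrace U s).isOpen.mem_nhds (hKU hy)] with z hz
      have h1 := Subtype.val_injective.extend_apply (G ∘ f) 0 (⟨z, hz⟩ : U)
      have h2 := Subtype.val_injective.extend_apply f 0 (⟨z, hz⟩ : U)
      simp only [Function.comp_apply] at h1 h2 ⊢
      rw [h1, h2]
    · refine (contMDiffAt_const (c := (0 : ℝ))).congr_of_eventuallyEq ?_
      filter_upwards [(hK.isClosed.isOpen_compl.preimage continuous_subtype_val).mem_nhds hy]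
        with z hz
      exact hzero z hz

variable (S) in
/-- A set `V`, necessarily open, with compact closure carrying finitely many smooth functions that
vanish outside of `V`, separate each point of `V` from every other point of `X`, and separate tangent
vectors to the strata at points of `V`. The function `h 0` is positive on `V`. -/
def IsSeparatedDomain (V : Set X) : Prop :=
  IsCompact (closure V) ∧ ∃ (N : ℕ) (h : Fin (N + 1) → X → ℝ),
    (∀ i, S.IsSmoothFunction (h i)) ∧ (∀ y ∈ V, 0 < h 0 y) ∧ (∀ i, ∀ y ∉ V, h i y = 0) ∧
    (∀ y ∈ V, ∀ z, (∀ i, h i y = h i z) → y = z) ∧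
    ∀ (s : S.strata) (y : (s : Set X)), (y : X) ∈ V → ∀ v : TangentSpace (𝓡 (S.dim s)) y, v ≠ 0 →
      ∃ i, mfderiv (𝓡 (S.dim s)) 𝓘(ℝ, ℝ) (fun x : (s : Set X) => h i x) y v ≠ 0

theorem IsSeparatedDomain.isOpen {V : Set X} (hV : S.IsSeparatedDomain V) : IsOpen V := by
  obtain ⟨-, N, h, hsm, hpos, hzero, -⟩ := hV
  have : V = h 0 ⁻¹' Set.Ioi 0 := by
    ext y
    refine ⟨hpos y, fun hy => ?_⟩
    by_contra hyV
    exact (Set.mem_Ioi.1 hy).ne' (hzero 0 y hyV)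
  rw [this]
  exact isOpen_Ioi.preimage (hsm 0).continuous

/-- If `φ` is a bump function around `f x` with small support, then `φ ∘ f` and the products
`(φ ∘ f) • f i` with the coordinates of `f` do separate: `f` is recovered as their quotient
where `φ ∘ f > 0`. -/
theorem IsLocalEmbedding.exists_isSeparatedDomain [T2Space X] [LocallyCompactSpace X]
    (hf : S.IsLocalEmbedding U f) {x : X} (hx : x ∈ U) {O : Set X} (hO : O ∈ 𝓝 x) :
    ∃ V ⊆ O, x ∈ V ∧ S.IsSeparatedDomain V := by
  obtain ⟨K, hKx, hKO, hK⟩ := local_compact_nhds (inter_mem hO (U.isOpen.mem_nhds hx))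
  have hKU : K ⊆ U := fun y hy => (hKO hy).2
  obtain ⟨r, hr, hball⟩ : ∃ r > 0, ∀ y : U, f y ∈ Metric.ball (f ⟨x, hx⟩) r → (y : X) ∈ K := by
    have h1 : Subtype.val ⁻¹' K ∈ 𝓝 (⟨x, hx⟩ : U) :=
      continuous_subtype_val.continuousAt.preimage_mem_nhds hKx
    rw [hf.1.isInducing.nhds_eq_comap] at h1
    obtain ⟨t, ht, htK⟩ := h1
    obtain ⟨r, hr, hrt⟩ := Metric.mem_nhds_iff.1 ht
    exact ⟨r, hr, fun y hy => htK (hrt hy)⟩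
  let φ : ContDiffBump (f ⟨x, hx⟩) := ⟨r / 2, r, by positivity, by linarith⟩
  have hφ : ContDiff ℝ ∞ φ := φ.contDiff
  have hφpos : ∀ z ∈ Metric.ball (f ⟨x, hx⟩) r, 0 < φ z := fun z hz => φ.pos_of_mem_ball hz
  have hφzero : ∀ z ∉ Metric.ball (f ⟨x, hx⟩) r, φ z = 0 := fun z hz =>
    φ.zero_of_le_dist (not_lt.1 hz)
  let G : Fin (N + 1) → EuclideanSpace ℝ (Fin N) → ℝ :=
    Fin.cons φ fun i z => φ z * z i
  have hGs : ∀ i, ContDiff ℝ ∞ (G i) := by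
    refine Fin.cases hφ fun i => ?_
    exact hφ.mul (EuclideanSpace.proj (𝕜 := ℝ) i).contDiff
  have hGz : ∀ i, ∀ z ∉ Metric.ball (f ⟨x, hx⟩) r, G i z = 0 := by
    refine Fin.cases hφzero fun i z hz => ?_
    simp [G, hφzero z hz]
  let V : Set X := Subtype.val '' (f ⁻¹' Metric.ball (f ⟨x, hx⟩) r)
  have hVK : V ⊆ K := by
    rintro _ ⟨y, hy, rfl⟩
    exact hball y hy
  let h : Fin (N + 1) → X → ℝ := fun i => Function.extend Subtype.val (G i ∘ f) 0
  have hh : ∀ i, ∀ y : U, h i y = G i (f y) := fun i y =>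
    Subtype.val_injective.extend_apply (G i ∘ f) 0 y
  have hhz : ∀ i, ∀ y ∉ V, h i y = 0 := by
    intro i y hy
    by_cases hyU : y ∈ U
    · rw [hh i ⟨y, hyU⟩]
      exact hGz i _ fun hb => hy ⟨⟨y, hyU⟩, hb, rfl⟩
    · exact Function.extend_apply' _ _ _ (by simpa using hyU)
  have hhpos : ∀ y ∈ V, 0 < h 0 y := by
    rintro _ ⟨y, hy, rfl⟩
    rw [hh]
    exact hφpos _ hy
  refine ⟨V, fun y hy => (hKO (hVK hy)).1, ⟨⟨x, hx⟩, Metric.mem_ball_self hr, rfl⟩,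
    hK.of_isClosed_subset isClosed_closure (hK.isClosed.closure_subset_iff.2 hVK), N, h, ?_,
    hhpos, hhz, ?_, ?_⟩
  · exact fun i => hf.isSmoothFunction_comp_extend hK hKU (hGs i) fun y hy =>
      hGz i _ fun hb => hy (hball y hb)
  · rintro y hyV z hyz
    have hzV : z ∈ V := by
      by_contra hz
      have := hyz 0
      rw [hhz 0 z hz] at this
      exact (hhpos y hyV).ne' this
    obtain ⟨y, hy, rfl⟩ := hyV
    obtain ⟨z, hz, rfl⟩ := hzV
    have h0 : φ (f y) = φ (f z) := by simpa [hh, G] using hyz 0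
    refine congrArg Subtype.val (hf.1.injective ?_)
    ext i
    have hi : φ (f y) * f y i = φ (f z) * f z i := by simpa [hh, G] using hyz i.succ
    rw [← h0] at hi
    exact mul_left_cancel₀ (hφpos _ hy).ne' hi
  · intro s y hyV v hv
    have hyU : (y : X) ∈ U := hKU (hVK hyV)
    have hb : f ⟨y, hyU⟩ ∈ Metric.ball (f ⟨x, hx⟩) r := by
      obtain ⟨y', hy', he⟩ := hyV
      rwa [← (Subtype.ext he : y' = ⟨y, hyU⟩)]
    set F : ↥(s : Set X) → EuclideanSpace ℝ (Fin N) :=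
      fun x => Function.extend Subtype.val f 0 (x : X) with hFdef
    have hF : ∀ z : (s : Set X), ∀ hz : (z : X) ∈ U, F z = f ⟨z, hz⟩ := fun z hz =>
      Subtype.val_injective.extend_apply f 0 (⟨z, hz⟩ : U)
    set w : EuclideanSpace ℝ (Fin N) := mfderiv (𝓡 (S.dim s)) (𝓡 N) F y v with hw
    have hw0 : w ≠ 0 := fun h0 => hv (hf.mfderiv_extend_injective s y hyU (by
      rw [map_zero]; exact h0))
    have hder : ∀ i, mfderiv (𝓡 (S.dim s)) 𝓘(ℝ, ℝ) (fun x : (s : Set X) => h i x) y v =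
        fderiv ℝ (G i) (F y) w := by
      intro i
      have heq : (fun x : (s : Set X) => h i x) =ᶠ[𝓝 y] G i ∘ F := by
        filter_upwards [(S.openTrace U s).isOpen.mem_nhds hyU] with z hz
        simp only [Function.comp_apply, hF z hz]
        exact hh i ⟨z, hz⟩
      rw [heq.mfderiv_eq, mfderiv_comp y
        (((hGs i).contMDiff.mdifferentiable (by simp)).mdifferentiableAt (x := F y))
        ((hf.contMDiffAt_extend s y hyU).mdifferentiableAt (by simp))]
      rw [mfderiv_eq_fderiv]
      rfl
    by_contra! hall
    have hall' : ∀ i, fderiv ℝ (G i) (F y) w = 0 := fun i => (hder i).symm.trans (hall i)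
    refine hw0 ?_
    ext i
    have hφd : DifferentiableAt ℝ φ (F y) := hφ.contDiffAt.differentiableAt (by simp)
    have hpd := (EuclideanSpace.proj (𝕜 := ℝ) i : EuclideanSpace ℝ (Fin N) →L[ℝ] ℝ).hasFDerivAt
      (x := F y)
    have h0 : fderiv ℝ φ (F y) w = 0 := hall' 0
    have hi := hall' i.succ
    have hGi : fderiv ℝ (G i.succ) (F y) = _ := (hφd.hasFDerivAt.mul hpd).fderiv
    rw [hGi] at hi
    simp [h0] at hi
    rcases hi with hi | hi
    · rw [hF y hyU] at hi
      exact absurd hi (hφpos _ hb).ne'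
    · simpa using hi

end ManifoldStratification

/-! ### A separating family and an exhaustion function -/

namespace ManifoldStratification

variable {X : Type u} [TopologicalSpace X] {S : ManifoldStratification X}

theorem IsSmoothFunction.const_smul {g : X → ℝ} (hg : S.IsSmoothFunction g) (c : ℝ) :
    S.IsSmoothFunction (c • g) :=
  ⟨hg.continuous.const_smul c, fun s => (contMDiff_const (c := c)).mul (hg.contMDiff s)⟩

theorem IsSmoothFunction.div {g g' : X → ℝ} (hg : S.IsSmoothFunction g)
    (hg' : S.IsSmoothFunction g') (h0 : ∀ x, g' x ≠ 0) :
    S.IsSmoothFunction fun x => g x / g' x :=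
  ⟨hg.continuous.div hg'.continuous h0,
    fun s => (hg.contMDiff s).div₀ (hg'.contMDiff s) fun x => h0 x⟩

theorem isSmoothFunction_finsum {ι : Type*} {g : ι → X → ℝ} (hg : ∀ k, S.IsSmoothFunction (g k))
    (hlf : LocallyFinite fun k => Function.support (g k)) :
    S.IsSmoothFunction fun x => ∑ᶠ k, g k x :=
  ⟨continuous_finsum (fun k => (hg k).continuous) hlf,
    fun s => contMDiff_finsum (fun k => (hg k).contMDiff s)
      (hlf.preimage_continuous continuous_subtype_val)⟩

/-- A smooth function tending to infinity: the weighted average `(∑ a, e a * φ a) / ∑ a, φ a`, where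
`e` is an injective map to `ℕ`. If `e a ≥ j` whenever `x ∈ V a`, then its value at `x` is at
least `j`. -/
theorem exists_isSmoothFunction_exhaustion {α : Type*} [Countable α] {V : α → Set X}
    (hV : ∀ a, IsCompact (closure (V a))) (hlf : LocallyFinite V) {φ : α → X → ℝ}
    (hφ : ∀ a, S.IsSmoothFunction (φ a)) (hnn : ∀ a x, 0 ≤ φ a x)
    (hsupp : ∀ a, ∀ x ∉ V a, φ a x = 0) (hpos : ∀ x, ∃ a, 0 < φ a x) :
    ∃ ρ : X → ℝ, S.IsSmoothFunction ρ ∧ ∀ m : ℝ, ∃ K, IsCompact K ∧ ∀ x ∉ K, m < ρ x := by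
  obtain ⟨e, he⟩ := Countable.exists_injective_nat α
  have hsub : ∀ a, Function.support (φ a) ⊆ V a := fun a x hx => by
    by_contra h
    exact hx (hsupp a x h)
  have hlf1 : LocallyFinite fun a => Function.support (φ a) := hlf.subset hsub
  have hlf2 : LocallyFinite fun a => Function.support ((e a : ℝ) • φ a) :=
    hlf1.subset fun a => Function.support_const_smul_subset _ _
  have hfin : ∀ x, (Function.support fun a => φ a x).Finite := fun x => hlf1.point_finite x
  have hsum : ∀ x, 0 < ∑ᶠ a, φ a x := by
    intro x
    obtain ⟨a, ha⟩ := hpos x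
    exact finsum_pos (fun a => hnn a x) ⟨a, ha⟩ (hfin x)
  refine ⟨fun x => (∑ᶠ a, ((e a : ℝ) • φ a) x) / ∑ᶠ a, φ a x,
    (isSmoothFunction_finsum (fun a => (hφ a).const_smul _) hlf2).div
      (isSmoothFunction_finsum hφ hlf1) fun x => (hsum x).ne', fun m => ?_⟩
  obtain ⟨j, hj⟩ := exists_nat_gt m
  refine ⟨⋃ a ∈ e ⁻¹' Set.Iio j, closure (V a),
    ((Set.finite_Iio j).preimage he.injOn).isCompact_biUnion fun a _ => hV a, fun x hx => ?_⟩
  refine hj.trans_le ((le_div_iff₀ (hsum x)).2 ?_)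
  rw [mul_finsum]
  refine finsum_le_finsum' ((hfin x).subset fun a ha => right_ne_zero_of_mul ha)
    ((hfin x).subset fun a ha => right_ne_zero_of_mul ha) fun a => ?_
  simp only [Pi.smul_apply, smul_eq_mul]
  by_cases hxa : x ∈ V a
  · refine mul_le_mul_of_nonneg_right ?_ (hnn a x)
    by_contra! hlt
    refine hx (Set.mem_iUnion₂.2 ⟨a, ?_, subset_closure hxa⟩)
    exact_mod_cast hlt
  · simp [hsupp a x hxa]

end ManifoldStratification

namespace SManifold

variable {n : ℕ} {X : Type u} [TopologicalSpace X] (S : SManifold n X)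

theorem exists_locallyFinite_isSeparatedDomain :
    ∃ (α : Type u) (V : α → Set X), Countable α ∧ (∀ a, S.IsSeparatedDomain (V a)) ∧
      LocallyFinite V ∧ ∀ x, ∃ a, x ∈ V a := by
  have := S.locallyCompactSpace
  have := S.t2Space
  have := S.secondCountableTopology
  have hB : ∀ x : X, (𝓝 x).HasBasis (fun V : Set X => x ∈ V ∧ S.IsSeparatedDomain V) id := by
    refine fun x => ⟨fun O => ⟨fun hO => ?_, ?_⟩⟩
    · obtain ⟨U, hxU, N, f, hf⟩ := S.exists_localEmbedding x
      obtain ⟨V, hVO, hxV, hV⟩ := hf.exists_isSeparatedDomain hxU hO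
      exact ⟨V, ⟨hxV, hV⟩, hVO⟩
    · rintro ⟨V, ⟨hxV, hV⟩, hVO⟩
      exact mem_of_superset (hV.isOpen.mem_nhds hxV) hVO
  obtain ⟨α, c, V, hV, hcov, hlf⟩ :=
    refinement_of_locallyCompact_sigmaCompact_of_nhds_basis.{u, u} hB
  refine ⟨α, V, ?_, fun a => (hV a).2, hlf, fun x => ?_⟩
  · exact Set.countable_univ_iff.1 (hlf.countable_univ fun a => ⟨c a, (hV a).1⟩)
  · simpa using Set.eq_univ_iff_forall.1 hcov x

/-- A locally finite countable family of smooth functions, with bounded absolute sum, which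
separates points and tangent vectors, together with a smooth function tending to infinity. -/
theorem exists_separating_family :
    ∃ (ι : Type u) (g : ι → X → ℝ) (ρ : X → ℝ), (∀ k, S.IsSmoothFunction (g k)) ∧
      S.IsSmoothFunction ρ ∧ (LocallyFinite fun k => Function.support (g k)) ∧
      (∀ m : ℝ, ∃ K, IsCompact K ∧ ∀ x ∉ K, m < ρ x) ∧
      (∃ C : ℝ, ∀ x, ∀ T : Finset ι, ∑ k ∈ T, |g k x| ≤ C) ∧
      (∀ x y, x ≠ y → ∃ k, g k x ≠ g k y) ∧
      ∀ (s : S.strata) (y : (s : Set X)) (v : TangentSpace (𝓡 (S.dim s)) y), v ≠ 0 →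
        ∃ k, mfderiv (𝓡 (S.dim s)) 𝓘(ℝ, ℝ) (fun x : (s : Set X) => g k x) y v ≠ 0 := by
  obtain ⟨α, V, hα, hV, hlf, hcov⟩ := S.exists_locallyFinite_isSeparatedDomain
  choose hcpt N h hsm hpos hzero hsep hder using hV
  obtain ⟨ρ, hρ, hρm⟩ := S.exists_isSmoothFunction_exhaustion hcpt hlf (φ := fun a => h a 0)
    (fun a => hsm a 0)
    (fun a x => by
      by_cases hx : x ∈ V a
      · exact (hpos a x hx).le
      · exact (hzero a 0 x hx).ge)
    (fun a => hzero a 0) (fun x => (hcov x).imp fun a ha => hpos a x ha)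
  have hbdd : ∀ k : Σ a, Fin (N a + 1), ∃ C > 0, ∀ x, |h k.1 k.2 x| ≤ C := by
    intro k
    have hsupp : HasCompactSupport (h k.1 k.2) :=
      HasCompactSupport.intro' (hcpt k.1) isClosed_closure fun x hx =>
        hzero k.1 k.2 x fun hxV => hx (subset_closure hxV)
    obtain ⟨C, hC⟩ := (hsm k.1 k.2).continuous.bounded_above_of_compact_support hsupp
    exact ⟨max C 1, by positivity, fun x => (hC x).trans (le_max_left _ _)⟩
  choose C hC0 hC using hbdd
  obtain ⟨e, he⟩ := Countable.exists_injective_nat (Σ a, Fin (N a + 1))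
  -- The scaling makes `|c k * h k| ≤ 2 ^ (-e k)`, which is summable.
  let c : (Σ a, Fin (N a + 1)) → ℝ := fun k => (1 / 2) ^ e k / C k
  have hc0 : ∀ k, 0 < c k := fun k => div_pos (by positivity) (hC0 k)
  refine ⟨Σ a, Fin (N a + 1), fun k => c k • h k.1 k.2, ρ, fun k => (hsm k.1 k.2).const_smul _, hρ,
    ?_, hρm, ⟨∑' k, (1 / 2 : ℝ) ^ e k, fun x T => ?_⟩, fun x y hxy => ?_, fun s y v hv => ?_⟩
  · have hlf' : LocallyFinite fun k : Σ a, Fin (N a + 1) => V k.1 := by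
      intro x
      obtain ⟨t, ht, hfin⟩ := hlf x
      refine ⟨t, ht, hfin.preimage' (f := Sigma.fst) fun a _ => ?_⟩
      refine (Set.finite_range (Sigma.mk a)).subset ?_
      rintro ⟨a', i⟩ rfl
      exact ⟨i, rfl⟩
    refine hlf'.subset fun k x hx => ?_
    by_contra hxV
    exact hx (by simp [hzero k.1 k.2 x hxV])
  · have hs : Summable fun k => (1 / 2 : ℝ) ^ e k :=
      summable_geometric_two.comp_injective he
    refine (Finset.sum_le_sum fun k _ => ?_).trans (hs.sum_le_tsum T fun k _ => by positivity)
    simp only [Pi.smul_apply, smul_eq_mul, abs_mul, abs_of_pos (hc0 k), c]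
    rw [div_mul_eq_mul_div, div_le_iff₀ (hC0 k)]
    exact mul_le_mul_of_nonneg_left (hC k x) (by positivity)
  · by_contra! hall
    obtain ⟨a, ha⟩ := hcov x
    refine hxy (hsep a x ha y fun i => ?_)
    exact mul_left_cancel₀ (hc0 ⟨a, i⟩).ne' (hall ⟨a, i⟩)
  · obtain ⟨a, ha⟩ := hcov y
    obtain ⟨i, hi⟩ := hder a s y ha v hv
    refine ⟨⟨a, i⟩, ?_⟩
    have h1 := const_smul_mfderiv
      (((hsm a i).contMDiff s).mdifferentiable (by simp) y) (c ⟨a, i⟩)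
    have h2 : mfderiv (𝓡 (S.dim s)) 𝓘(ℝ, ℝ) (fun x : (s : Set X) => (c ⟨a, i⟩ • h a i) x) y v =
        c ⟨a, i⟩ • mfderiv (𝓡 (S.dim s)) 𝓘(ℝ, ℝ) (fun x : (s : Set X) => h a i x) y v :=
      congrArg (fun A : TangentSpace (𝓡 (S.dim s)) y →L[ℝ] ℝ => A v) h1
    intro h3
    exact smul_ne_zero (hc0 ⟨a, i⟩).ne' hi (h2.symm.trans h3)

end SManifold

/-! ### Generic combinations are proper embeddings -/

section PerturbedSum

variable {X ι W : Type*} [NormedAddCommGroup W] [NormedSpace ℝ W]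

/-- The map `ρ • w + ∑ k, g k • a k` from `X` to `W` given by a bounded family `a` of coefficients.
The sum is a finite sum at every point as soon as the family `g` is locally finite. -/
noncomputable def perturbedSum (g : ι → X → ℝ) (ρ : X → ℝ) (w : W) (a : lp (fun _ : ι => W) ⊤)
    (x : X) : W :=
  ρ x • w + ∑ᶠ k, g k x • a k

variable {g : ι → X → ℝ} {ρ : X → ℝ} {w : W}

theorem perturbedSum_eq {T : Finset ι} {x : X} (hT : ∀ k ∉ T, g k x = 0)
    (a : lp (fun _ : ι => W) ⊤) :
    perturbedSum g ρ w a x = ρ x • w + ∑ k ∈ T, g k x • a k := by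
  rw [perturbedSum, finsum_eq_sum_of_support_subset]
  intro k hk
  by_contra hkT
  exact hk (by simp [hT k hkT])

theorem LocallyFinite.exists_finset_eventually_eq_zero [TopologicalSpace X]
    (hg : LocallyFinite fun k => Function.support (g k)) (x : X) :
    ∃ T : Finset ι, ∀ᶠ y in 𝓝 x, ∀ k ∉ T, g k y = 0 := by
  obtain ⟨T, hT⟩ := hg.exists_finset_support x
  exact ⟨T, hT.mono fun y hy k hk => by_contra fun h => hk (hy h)⟩

theorem le_norm_perturbedSum {C : ℝ} (hg : ∀ x, (Function.support fun k => g k x).Finite)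
    (hC : ∀ x, ∀ T : Finset ι, ∑ k ∈ T, |g k x| ≤ C)
    (hw : ‖w‖ = 1) (a : lp (fun _ : ι => W) ⊤) (x : X) :
    ρ x - C * ‖a‖ ≤ ‖perturbedSum g ρ w a x‖ := by
  have hT : ∀ k ∉ (hg x).toFinset, g k x = 0 := fun k hk => by simpa using hk
  rw [perturbedSum_eq hT]
  set T := (hg x).toFinset
  have h1 : ‖∑ k ∈ T, g k x • a k‖ ≤ C * ‖a‖ := by
    refine (norm_sum_le _ _).trans ?_
    refine (Finset.sum_le_sum (g := fun k => |g k x| * ‖a‖) fun k _ => ?_).trans ?_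
    · rw [norm_smul, Real.norm_eq_abs]
      exact mul_le_mul_of_nonneg_left (lp.norm_apply_le_norm ENNReal.top_ne_zero a k)
        (abs_nonneg _)
    · rw [← Finset.sum_mul]
      exact mul_le_mul_of_nonneg_right (hC x T) (norm_nonneg a)
  have h2 : ρ x ≤ ‖ρ x • w‖ := by
    rw [norm_smul, hw, mul_one]
    exact le_abs_self _
  have h3 := norm_sub_le_norm_add (ρ x • w) (∑ k ∈ T, g k x • a k)
  linarith

end PerturbedSum

namespace ManifoldStratification

variable {X : Type u} [TopologicalSpace X] {S : ManifoldStratification X} {ι : Type*}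
  {g : ι → X → ℝ} {ρ : X → ℝ} {m : ℕ} {w : EuclideanSpace ℝ (Fin m)}

theorem continuous_perturbedSum (hg : ∀ k, S.IsSmoothFunction (g k)) (hρ : S.IsSmoothFunction ρ)
    (hlf : LocallyFinite fun k => Function.support (g k))
    (a : lp (fun _ : ι => EuclideanSpace ℝ (Fin m)) ⊤) :
    Continuous (perturbedSum g ρ w a) :=
  (hρ.continuous.smul continuous_const).add
    (continuous_finsum (fun k => (hg k).continuous.smul continuous_const)
      (hlf.subset fun k => Function.support_smul_subset_left (g k) fun _ => a k))

theorem contMDiff_perturbedSum (hg : ∀ k, S.IsSmoothFunction (g k)) (hρ : S.IsSmoothFunction ρ)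
    (hlf : LocallyFinite fun k => Function.support (g k))
    (a : lp (fun _ : ι => EuclideanSpace ℝ (Fin m)) ⊤) (s : S.strata) :
    ContMDiff (𝓡 (S.dim s)) (𝓡 m) ∞ (fun x : (s : Set X) => perturbedSum g ρ w a x) :=
  ((hρ.contMDiff s).smul contMDiff_const).add
    (contMDiff_finsum (fun k => ((hg k).contMDiff s).smul contMDiff_const)
      ((hlf.preimage_continuous continuous_subtype_val).subset fun k =>
        Function.support_smul_subset_left (fun x : (s : Set X) => g k x) fun _ => a k))

theorem isProperMap_perturbedSum [T2Space X] (hg : ∀ k, S.IsSmoothFunction (g k))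
    (hρ : S.IsSmoothFunction ρ) (hlf : LocallyFinite fun k => Function.support (g k))
    (hρm : ∀ m : ℝ, ∃ K, IsCompact K ∧ ∀ x ∉ K, m < ρ x) {C : ℝ}
    (hC : ∀ x, ∀ T : Finset ι, ∑ k ∈ T, |g k x| ≤ C) (hw : ‖w‖ = 1)
    (a : lp (fun _ : ι => EuclideanSpace ℝ (Fin m)) ⊤) :
    IsProperMap (perturbedSum g ρ w a) := by
  have hcont := continuous_perturbedSum (w := w) hg hρ hlf a
  refine isProperMap_iff_isCompact_preimage.2 ⟨hcont, fun K hK => ?_⟩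
  obtain ⟨R, hR⟩ := hK.isBounded.exists_norm_le
  obtain ⟨K', hK', hlt⟩ := hρm (R + C * ‖a‖)
  refine hK'.of_isClosed_subset (hK.isClosed.preimage hcont) fun x hx => ?_
  by_contra hxK
  have h1 := le_norm_perturbedSum (ρ := ρ) (fun x => hlf.point_finite x) hC hw a x
  have h2 := hR _ hx
  have h3 := hlt x hxK
  linarith

theorem IsSmoothFunction.contDiffOn_comp_chart_symm {q : X → ℝ} (hq : S.IsSmoothFunction q)
    (s : S.strata) (c : (s : Set X)) :
    ContDiffOn ℝ ∞ (fun u => q ((chartAt (EuclideanSpace ℝ (Fin (S.dim s))) c).symm u))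
      (chartAt (EuclideanSpace ℝ (Fin (S.dim s))) c).target :=
  contMDiffOn_iff_contDiffOn.1 ((hq.contMDiff s).comp_contMDiffOn contMDiffOn_chart_symm)

/-- Two points of given charts of two strata have different images for generic `a`, since the pairs
of such points are parametrized by an open set of dimension `S.dim s + S.dim t < m`. -/
theorem residual_ne_on_charts [T2Space X] (hg : ∀ k, S.IsSmoothFunction (g k))
    (hρ : S.IsSmoothFunction ρ)
    (hlf : LocallyFinite fun k => Function.support (g k))
    (hsep : ∀ x y, x ≠ y → ∃ k, g k x ≠ g k y) (s t : S.strata) (c : (s : Set X)) (b : (t : Set X))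
    (hdim : S.dim s + S.dim t < m) :
    ∀ᶠ a in residual (lp (fun _ : ι => EuclideanSpace ℝ (Fin m)) ⊤),
      ∀ x ∈ (chartAt (EuclideanSpace ℝ (Fin (S.dim s))) c).source,
      ∀ y ∈ (chartAt (EuclideanSpace ℝ (Fin (S.dim t))) b).source, (x : X) ≠ y →
        perturbedSum g ρ w a x ≠ perturbedSum g ρ w a y := by
  classical
  set φ := chartAt (EuclideanSpace ℝ (Fin (S.dim s))) c
  set ψ := chartAt (EuclideanSpace ℝ (Fin (S.dim t))) b
  let p : EuclideanSpace ℝ (Fin (S.dim s)) × EuclideanSpace ℝ (Fin (S.dim t)) → X :=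
    fun z => φ.symm z.1
  let q : EuclideanSpace ℝ (Fin (S.dim s)) × EuclideanSpace ℝ (Fin (S.dim t)) → X :=
    fun z => ψ.symm z.2
  have hO : IsOpen (φ.target ×ˢ ψ.target) := φ.open_target.prod ψ.open_target
  have hp : ContinuousOn p (φ.target ×ˢ ψ.target) := continuous_subtype_val.comp_continuousOn
    (φ.symm.continuousOn.comp continuousOn_fst fun z hz => hz.1)
  have hq : ContinuousOn q (φ.target ×ˢ ψ.target) := continuous_subtype_val.comp_continuousOn
    (ψ.symm.continuousOn.comp continuousOn_snd fun z hz => hz.2)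
  have hZ : IsOpen ((φ.target ×ˢ ψ.target) ∩ (fun z => (p z, q z)) ⁻¹' (Set.diagonal X)ᶜ) :=
    (hp.prodMk hq).isOpen_inter_preimage hO isClosed_diagonal.isOpen_compl
  have hsmooth : ∀ r : X → ℝ, S.IsSmoothFunction r → ContDiffOn ℝ 1 (fun z => r (p z) - r (q z))
      ((φ.target ×ˢ ψ.target) ∩ (fun z => (p z, q z)) ⁻¹' (Set.diagonal X)ᶜ) := by
    intro r hr
    refine ContDiffOn.sub ?_ ?_
    · exact ((hr.contDiffOn_comp_chart_symm s c).of_le (by simp)).comp contDiffOn_fst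
        fun z hz => hz.1.1
    · exact ((hr.contDiffOn_comp_chart_symm t b).of_le (by simp)).comp contDiffOn_snd
        fun z hz => hz.1.2
  have key := residual_forall_ne_zero (ι := ι) (W := EuclideanSpace ℝ (Fin m))
    (by simpa using hdim) hZ (G := fun k z => g k (p z) - g k (q z))
    (G₀ := fun z => (ρ (p z) - ρ (q z)) • w)
    (F := fun a z => perturbedSum g ρ w a (p z) - perturbedSum g ρ w a (q z))
    (fun k => hsmooth _ (hg k)) ((hsmooth _ hρ).smul contDiffOn_const) ?_ ?_
  · filter_upwards [key] with a ha x hx y hy hxy heq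
    refine ha (φ x, ψ y) ⟨⟨φ.map_source hx, ψ.map_source hy⟩, ?_⟩ ?_
    · simpa [p, q, φ.left_inv hx, ψ.left_inv hy] using hxy
    · simpa [p, q, φ.left_inv hx, ψ.left_inv hy, sub_eq_zero] using heq
  · intro z hz
    obtain ⟨T₁, hT₁⟩ := hlf.exists_finset_eventually_eq_zero (p z)
    obtain ⟨T₂, hT₂⟩ := hlf.exists_finset_eventually_eq_zero (q z)
    refine ⟨T₁ ∪ T₂, ?_⟩
    filter_upwards [(hp.continuousAt (hO.mem_nhds hz.1)).eventually hT₁,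
      (hq.continuousAt (hO.mem_nhds hz.1)).eventually hT₂] with z' h₁ h₂
    have h₁' : ∀ k ∉ T₁ ∪ T₂, g k (p z') = 0 := fun k hk =>
      h₁ k fun h => hk (Finset.mem_union_left _ h)
    have h₂' : ∀ k ∉ T₁ ∪ T₂, g k (q z') = 0 := fun k hk =>
      h₂ k fun h => hk (Finset.mem_union_right _ h)
    refine ⟨fun k hk => by rw [h₁' k hk, h₂' k hk, sub_zero], fun a => ?_⟩
    rw [perturbedSum_eq h₁', perturbedSum_eq h₂']
    simp only [sub_smul, Finset.sum_sub_distrib]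
    abel
  · intro z hz
    obtain ⟨k, hk⟩ := hsep (p z) (q z) hz.2
    exact ⟨k, sub_ne_zero.2 hk⟩

/-- The differential is injective on a given chart of a stratum for generic `a`, since the nonzero
tangent vectors are parametrized by an open set of dimension `2 * S.dim s < m`. -/
theorem residual_fderiv_ne_zero (hg : ∀ k, S.IsSmoothFunction (g k)) (hρ : S.IsSmoothFunction ρ)
    (hlf : LocallyFinite fun k => Function.support (g k)) (s : S.strata)
    (hder : ∀ (y : (s : Set X)) (v : TangentSpace (𝓡 (S.dim s)) y), v ≠ 0 →
      ∃ k, mfderiv (𝓡 (S.dim s)) 𝓘(ℝ, ℝ) (fun x : (s : Set X) => g k x) y v ≠ 0)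
    (c : (s : Set X)) (hdim : S.dim s + S.dim s < m) :
    ∀ᶠ a in residual (lp (fun _ : ι => EuclideanSpace ℝ (Fin m)) ⊤),
      ∀ u ∈ (chartAt (EuclideanSpace ℝ (Fin (S.dim s))) c).target, ∀ v ≠ 0,
        fderiv ℝ (fun u => perturbedSum g ρ w a
          ((chartAt (EuclideanSpace ℝ (Fin (S.dim s))) c).symm u)) u v ≠ 0 := by
  set φ := chartAt (EuclideanSpace ℝ (Fin (S.dim s))) c with hφdef
  have hφs : ∀ r : X → ℝ, S.IsSmoothFunction r → ∀ u ∈ φ.target,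
      DifferentiableAt ℝ (fun u => r (φ.symm u)) u := fun r hr u hu =>
    ((hr.contDiffOn_comp_chart_symm s c).contDiffAt (φ.open_target.mem_nhds hu)).differentiableAt
      (by simp)
  have hsmooth : ∀ r : X → ℝ, S.IsSmoothFunction r → ContDiffOn ℝ 1
      (fun z : EuclideanSpace ℝ (Fin (S.dim s)) × EuclideanSpace ℝ (Fin (S.dim s)) =>
        fderiv ℝ (fun u => r (φ.symm u)) z.1 z.2) (φ.target ×ˢ {0}ᶜ) := by
    intro r hr
    have h1 : ContDiffOn ℝ 1 (fderiv ℝ (fun u => r (φ.symm u))) φ.target :=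
      (hr.contDiffOn_comp_chart_symm s c).fderiv_of_isOpen φ.open_target (by norm_cast)
    exact (h1.comp contDiffOn_fst fun z hz => hz.1).clm_apply contDiffOn_snd
  have key := residual_forall_ne_zero (ι := ι) (W := EuclideanSpace ℝ (Fin m))
    (E := EuclideanSpace ℝ (Fin (S.dim s)) × EuclideanSpace ℝ (Fin (S.dim s)))
    (by simpa using hdim) (φ.open_target.prod isOpen_compl_singleton)
    (G := fun k z => fderiv ℝ (fun u => g k (φ.symm u)) z.1 z.2)
    (G₀ := fun z => fderiv ℝ (fun u => ρ (φ.symm u)) z.1 z.2 • w)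
    (F := fun a z => fderiv ℝ (fun u => perturbedSum g ρ w a (φ.symm u)) z.1 z.2)
    (fun k => hsmooth _ (hg k)) ((hsmooth _ hρ).smul contDiffOn_const) ?_ ?_
  · filter_upwards [key] with a ha u hu v hv
    exact ha (u, v) ⟨hu, hv⟩
  · rintro ⟨u, v⟩ ⟨hu, -⟩
    obtain ⟨T, hT⟩ := hlf.exists_finset_eventually_eq_zero (φ.symm u : X)
    refine ⟨T, ?_⟩
    have hc : ContinuousAt (fun u => (φ.symm u : X)) u :=
      continuous_subtype_val.continuousAt.comp (φ.symm.continuousAt hu)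
    have hT' : ∀ᶠ u' in 𝓝 u, u' ∈ φ.target ∧ ∀ᶠ u'' in 𝓝 u', ∀ k ∉ T, g k (φ.symm u'') = 0 :=
      (φ.open_target.eventually_mem hu).and (hc.eventually hT).eventually_nhds
    filter_upwards [(continuous_fst.tendsto (u, v)).eventually hT'] with ⟨u', v'⟩ ⟨hu', hz⟩
    refine ⟨fun k hk => ?_, fun a => ?_⟩
    · have : (fun u => g k (φ.symm u)) =ᶠ[𝓝 u'] fun _ => 0 := hz.mono fun u'' h => h k hk
      simp [this.fderiv_eq]
    · have h1 : (fun u => perturbedSum g ρ w a (φ.symm u)) =ᶠ[𝓝 u']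
          fun u => ρ (φ.symm u) • w + ∑ k ∈ T, g k (φ.symm u) • a k :=
        hz.mono fun u'' h => perturbedSum_eq h a
      have h2 : HasFDerivAt (fun u => ρ (φ.symm u) • w + ∑ k ∈ T, g k (φ.symm u) • a k) _ u' :=
        ((hφs ρ hρ u' hu').hasFDerivAt.smul_const w).add
          (HasFDerivAt.fun_sum fun k _ => (hφs (g k) (hg k) u' hu').hasFDerivAt.smul_const (a k))
      simp only [h1.fderiv_eq, h2.fderiv]
      simp
  · rintro ⟨u, v⟩ ⟨hu, hv⟩
    have hφ : φ.MDifferentiable (𝓡 (S.dim s)) (𝓡 (S.dim s)) := by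
      have : IsManifold (𝓡 (S.dim s)) 1 (s : Set X) := IsManifold.of_le (n := ∞) (by simp)
      exact mdifferentiable_chart c
    have hv' : mfderiv (𝓡 (S.dim s)) (𝓡 (S.dim s)) φ.symm u v ≠ 0 := fun h =>
      hv (hφ.symm.mfderiv_injective hu (h.trans (map_zero _).symm))
    obtain ⟨k, hk⟩ := hder _ _ hv'
    refine ⟨k, fun h0 => hk ?_⟩
    have h1 := mfderiv_comp (I'' := 𝓘(ℝ, ℝ)) u
      (((hg k).contMDiff s).mdifferentiable (by simp) (φ.symm u))
      (hφ.mdifferentiableAt_symm hu)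
    rw [mfderiv_eq_fderiv] at h1
    exact (congrArg (fun A : EuclideanSpace ℝ (Fin (S.dim s)) →L[ℝ] ℝ => A v) h1).symm.trans h0

theorem exists_countable_chart_cover [SecondCountableTopology X] (s : S.strata) :
    ∃ t : Set (s : Set X), t.Countable ∧
      ∀ x, ∃ c ∈ t, x ∈ (chartAt (EuclideanSpace ℝ (Fin (S.dim s))) c).source := by
  obtain ⟨t, ht, htu⟩ := TopologicalSpace.countable_cover_nhds fun x : (s : Set X) =>
    chart_source_mem_nhds (EuclideanSpace ℝ (Fin (S.dim s))) x
  exact ⟨t, ht, fun x => by simpa using Set.eq_univ_iff_forall.1 htu x⟩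

end ManifoldStratification

open ManifoldStratification in
theorem theorem3p19 {n : ℕ} {X : Type*} [TopologicalSpace X] (S : SManifold n X) :
    ∃ f : X → EuclideanSpace ℝ (Fin (2 * n + 1)), S.IsEmbedding f ∧ IsProperMap f := by
  have := S.locallyCompactSpace
  have := S.t2Space
  have := S.secondCountableTopology
  have := S.countable_strata.to_subtype
  obtain ⟨ι, g, ρ, hg, hρ, hlf, hρm, ⟨C, hC⟩, hsep, hder⟩ := S.exists_separating_family
  choose t htc ht using S.exists_countable_chart_cover
  have hw : ‖EuclideanSpace.single (0 : Fin (2 * n + 1)) (1 : ℝ)‖ = 1 := by simp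
  set w := EuclideanSpace.single (0 : Fin (2 * n + 1)) (1 : ℝ)
  have hgen₁ : ∀ᶠ a in residual (lp (fun _ : ι => EuclideanSpace ℝ (Fin (2 * n + 1))) ⊤),
      ∀ s, ∀ c ∈ t s, ∀ s', ∀ c' ∈ t s',
        ∀ x ∈ (chartAt (EuclideanSpace ℝ (Fin (S.dim s))) c).source,
        ∀ y ∈ (chartAt (EuclideanSpace ℝ (Fin (S.dim s'))) c').source, (x : X) ≠ y →
          perturbedSum g ρ w a x ≠ perturbedSum g ρ w a y :=
    eventually_countable_forall.2 fun s => (eventually_countable_ball (htc s)).2 fun c _ =>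
      eventually_countable_forall.2 fun s' => (eventually_countable_ball (htc s')).2 fun c' _ =>
        residual_ne_on_charts (w := w) hg hρ hlf hsep s s' c c' (by
          have := S.dim_le s
          have := S.dim_le s'
          omega)
  have hgen₂ : ∀ᶠ a in residual (lp (fun _ : ι => EuclideanSpace ℝ (Fin (2 * n + 1))) ⊤),
      ∀ s, ∀ c ∈ t s,
        ∀ u ∈ (chartAt (EuclideanSpace ℝ (Fin (S.dim s))) c).target, ∀ v ≠ 0,
          fderiv ℝ (fun u => perturbedSum g ρ w a
            ((chartAt (EuclideanSpace ℝ (Fin (S.dim s))) c).symm u)) u v ≠ 0 :=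
    eventually_countable_forall.2 fun s => (eventually_countable_ball (htc s)).2 fun c _ =>
      residual_fderiv_ne_zero (w := w) hg hρ hlf s (hder s) c (by
        have := S.dim_le s
        omega)
  obtain ⟨a, hinj, himm⟩ := (dense_of_mem_residual (hgen₁.and hgen₂)).nonempty
  set f := perturbedSum g ρ w a
  have hproper : IsProperMap f := isProperMap_perturbedSum hg hρ hlf hρm hC hw a
  have hfinj : Function.Injective f := by
    intro x y hxy
    by_contra hne
    obtain ⟨s, hs, hxs⟩ := Set.mem_sUnion.1 (S.sUnion_eq.ge (Set.mem_univ x))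
    obtain ⟨s', hs', hys⟩ := Set.mem_sUnion.1 (S.sUnion_eq.ge (Set.mem_univ y))
    obtain ⟨c, hc, hxc⟩ := ht ⟨s, hs⟩ ⟨x, hxs⟩
    obtain ⟨c', hc', hyc⟩ := ht ⟨s', hs'⟩ ⟨y, hys⟩
    exact hinj ⟨s, hs⟩ c hc ⟨s', hs'⟩ c' hc' ⟨x, hxs⟩ hxc ⟨y, hys⟩ hyc hne hxy
  have hemb : Topology.IsEmbedding f :=
    (IsClosedEmbedding.of_continuous_injective_isClosedMap hproper.continuous hfinj
      hproper.isClosedMap).isEmbedding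
  have hsm : ∀ s : S.strata, ContMDiff (𝓡 (S.dim s)) (𝓡 (2 * n + 1)) ∞
      (fun x : (s : Set X) => f x) := fun s => contMDiff_perturbedSum hg hρ hlf a s
  refine ⟨f, ⟨⟨hproper.continuous, hsm⟩, fun s => ⟨?_, hemb.comp IsEmbedding.subtypeVal⟩, hemb⟩,
    hproper⟩
  refine ⟨EuclideanSpace ℝ (Fin (2 * n + 1 - S.dim s)), inferInstance, inferInstance, fun x => ?_⟩
  obtain ⟨c, hc, hxc⟩ := ht s x
  refine isImmersionAtOfComplement_of_injective_fderiv (hsm s)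
    (IsManifold.chart_mem_maximalAtlas c) hxc ?_
  refine (injective_iff_map_eq_zero _).2 fun v hv => ?_
  by_contra hv0
  exact himm s c hc _ (OpenPartialHomeomorph.map_source _ hxc) v hv0 hv
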